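/- Let $1<p<\infty$ and let $V,W:(0,\infty)\to[0,\infty]$ be measurable functions that are finite almost everywhere, such that $$\int_s^\infty V(t)^{-\frac1{p-1}}\,dt<\infty\qquad\text{for all } s\in(0,\infty)$$ (with the conventions $0^{-1/(p-1)}=\infty$ and $\infty^{-1/(p-1)}=0$). Define $$\overline B':=\sup_{s>0}\left(\int_s^\infty V(t)^{-\frac1{p-1}}\,dt\right)^{p-1}\left(\int_0^s W(t)\,dt\right)$$ and $$\underline B':=\sup_{s>0}\left(\int_s^\infty V(t)^{-\frac1{p-1}}\,dt\right)^{-1}\int_s^\infty W(t)\left(\int_t^\infty V(t')^{-\frac1{p-1}}\,dt'\right)^p dt ,$$ both with values in $[0,\infty]$. Then for every (real- or complex-valued) locally absolutely continuous function $u$ on $(0,\infty)$ with $\liminf_{r\to\infty}|u(r)|=0$, $$\int_0^\infty W(r)|u(r)|^p\,dr\le\frac{p^p}{(p-1)^{p-1}}\,\overline B'\int_0^\infty V(r)|u'(r)|^p\,dr$$ and $$\int_0^\infty W(r)|u(r)|^p\,dr\le\left(\frac p{p-1}\right)^p\underline B'\int_0^\infty V(r)|u'(r)|^p\,dr ,$$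 where all quantities take values in $[0,\infty]$ and $0\cdot\infty=0$. -/

import Mathlib

open MeasureTheory Set Filter
open scoped ENNReal

/-- `u` is locally absolutely continuous on `(0, ∞)`: it is absolutely continuous on every
compact interval `[a, b] ⊂ (0, ∞)`. Values of `u` outside `(0, ∞)` play no role. -/
def LocallyACOnPos {𝕜 : Type*} [RCLike 𝕜] (u : ℝ → 𝕜) : Prop :=
  ∀ a b : ℝ, 0 < a → a ≤ b → AbsolutelyContinuousOnInterval u a b

/-- The tail integral `∫_s^∞ V(t)^{-1/(p-1)} dt`, with `0^{-1/(p-1)} = ∞` and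
`∞^{-1/(p-1)} = 0`. -/
noncomputable def tailInt (p : ℝ) (V : ℝ → ℝ≥0∞) (s : ℝ) : ℝ≥0∞ :=
  ∫⁻ t in Ioi s, V t ^ (-(1 / (p - 1)))

/-- `sup_{s>0} (∫_s^∞ V^{-1/(p-1)})^{p-1} ∫_0^s W`. -/
noncomputable def upperB (p : ℝ) (V W : ℝ → ℝ≥0∞) : ℝ≥0∞ :=
  ⨆ (s : ℝ) (_ : 0 < s), tailInt p V s ^ (p - 1) * ∫⁻ t in Ioo 0 s, W t

/-- `sup_{s>0} (∫_s^∞ V^{-1/(p-1)})^{-1} ∫_s^∞ W(t) (∫_t^∞ V^{-1/(p-1)})^p dt`. -/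
noncomputable def lowerB (p : ℝ) (V W : ℝ → ℝ≥0∞) : ℝ≥0∞ :=
  ⨆ (s : ℝ) (_ : 0 < s), (tailInt p V s)⁻¹ * ∫⁻ t in Ioi s, W t * tailInt p V t ^ p

/-! Put `f = |u'|`, `F(r) = ∫_r^∞ f`, `v = V^{-1/(p-1)}`, `Φ(r) = ∫_r^∞ v`. Absolute continuity and
the liminf condition give `|u| ≤ F`, so both bounds are proved for `F` (`weighted_hardy_tail`).

For `upperB = B`, Hölder with a power of `Φ` as auxiliary weight bounds `F(r)^p` by a power of
`Φ(r)` times a tail integral of `V f^p Φ^{1-1/p}`. With `H(r) = ∫_0^r W`, the bound `Φ^{p-1} ≤ B /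
H` replaces that power by one of `H`; after Tonelli, the inner integral of `W H^{-(1-1/p)}` is at
most `p H^{1/p}`, and `Φ^{p-1} H ≤ B` is used again.

For `lowerB = B`, `F/Φ` is the average of `g = f/v` over `(s, ∞)` for `dν = v dt`. Its running
supremum `X` satisfies Doob's weak-type bound, and `dω = W Φ^p dt` satisfies `ω(s, ∞) ≤ B ν(s, ∞)`.
Doob's `L^p` argument then bounds `∫ X^p dω`, which dominates `∫ W F^p`, by `∫ g^p dν = ∫ V f^p`. -/

/-! ### Reduction of `u` to the tail integral of its derivative. -/

theorem LipschitzWith.comp_absolutelyContinuousOnInterval {X Y : Type*} [PseudoMetricSpace X]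
    [PseudoMetricSpace Y] {φ : X → Y} {K : NNReal} (hφ : LipschitzWith K φ) {u : ℝ → X} {a b : ℝ}
    (hu : AbsolutelyContinuousOnInterval u a b) :
    AbsolutelyContinuousOnInterval (φ ∘ u) a b := by
  unfold AbsolutelyContinuousOnInterval at *
  have h := hu.const_mul (K : ℝ)
  rw [mul_zero] at h
  refine squeeze_zero (fun E => Finset.sum_nonneg fun _ _ => dist_nonneg) (fun E => ?_) h
  rw [Finset.mul_sum]
  exact Finset.sum_le_sum fun i _ => hφ.dist_le_mul _ _

theorem AbsolutelyContinuousOnInterval.enorm_sub_le_lintegral_deriv {𝕜 : Type*} [RCLike 𝕜]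
    {u : ℝ → 𝕜} {a b : ℝ} (hab : a ≤ b) (hu : AbsolutelyContinuousOnInterval u a b) :
    ‖u b - u a‖ₑ ≤ ∫⁻ t in Ioc a b, ‖deriv u t‖ₑ := by
  have hdiff : ∀ᵐ x, x ∈ uIcc a b → DifferentiableAt ℝ u x :=
    hu.boundedVariationOn.ae_differentiableAt_of_mem_uIcc
  -- Rotating the increment onto the positive real axis reduces to the real function `re (c * u)`,
  -- whose derivative is dominated by that of `u`.
  obtain ⟨c, hc, hcu⟩ : ∃ c : 𝕜, ‖c‖ ≤ 1 ∧ c * (u b - u a) = (‖u b - u a‖ : 𝕜) := by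
    by_cases h : u b - u a = 0
    · exact ⟨0, by simp, by simp [h]⟩
    · have h' : (‖u b - u a‖ : 𝕜) ≠ 0 := by simpa using h
      refine ⟨(starRingEnd 𝕜) (u b - u a) / ‖u b - u a‖, ?_, ?_⟩
      · rw [norm_div, RCLike.norm_conj, RCLike.norm_ofReal, abs_norm]
        exact div_self_le_one _
      · rw [div_mul_eq_mul_div, RCLike.conj_mul, sq, mul_div_assoc, div_self h', mul_one]
  let ℓ : 𝕜 →L[ℝ] ℝ := (RCLike.reCLM).comp ((ContinuousLinearMap.mul ℝ 𝕜) c)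
  have hℓ : ∀ z, ℓ z = RCLike.re (c * z) := fun z => rfl
  have hℓn : ∀ z, ‖ℓ z‖ ≤ ‖z‖ := fun z => by
    rw [hℓ]
    calc ‖RCLike.re (c * z)‖ ≤ ‖c * z‖ := by simpa using RCLike.abs_re_le_norm (c * z)
      _ = ‖c‖ * ‖z‖ := norm_mul _ _
      _ ≤ 1 * ‖z‖ := by gcongr
      _ = ‖z‖ := one_mul _
  have hac : AbsolutelyContinuousOnInterval (ℓ ∘ u) a b :=
    ℓ.lipschitz.comp_absolutelyContinuousOnInterval hu
  have hftc := hac.integral_deriv_eq_sub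
  have hval : (ℓ ∘ u) b - (ℓ ∘ u) a = ‖u b - u a‖ := by
    rw [Function.comp_apply, Function.comp_apply, ← map_sub, hℓ, hcu, RCLike.ofReal_re]
  have hnorm : ‖u b - u a‖ₑ = ‖∫ t in a..b, deriv (ℓ ∘ u) t‖ₑ := by
    rw [hftc, hval, enorm_norm]
  rw [hnorm, intervalIntegral.integral_of_le hab]
  refine (enorm_integral_le_lintegral_enorm _).trans (setLIntegral_mono_ae' measurableSet_Ioc ?_)
  filter_upwards [hdiff] with x hx hxab
  have hd := (hx (by rw [uIcc_of_le hab]; exact Ioc_subset_Icc_self hxab)).hasDerivAt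
  rw [(ℓ.hasFDerivAt.comp_hasDerivAt x hd).deriv]
  exact enorm_le_iff_norm_le.2 (hℓn _)

theorem LocallyACOnPos.enorm_le_lintegral_deriv {𝕜 : Type*} [RCLike 𝕜]
    {u : ℝ → 𝕜} (hu : LocallyACOnPos u)
    (hlim : liminf (fun r : ℝ => ‖u r‖ₑ) atTop = 0) {r : ℝ} (hr : 0 < r) :
    ‖u r‖ₑ ≤ ∫⁻ t in Ioi r, ‖deriv u t‖ₑ := by
  refine ENNReal.le_of_forall_pos_le_add fun ε hε _ => ?_
  have hfreq : ∃ᶠ R in atTop, ‖u R‖ₑ < ε :=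
    frequently_lt_of_liminf_lt (by isBoundedDefault) (by rw [hlim]; exact_mod_cast hε)
  obtain ⟨R, hR, hrR⟩ := (hfreq.and_eventually (eventually_ge_atTop r)).exists
  calc ‖u r‖ₑ = ‖u R - (u R - u r)‖ₑ := by rw [sub_sub_cancel]
    _ ≤ ‖u R‖ₑ + ‖u R - u r‖ₑ := enorm_sub_le
    _ ≤ ε + ∫⁻ t in Ioi r, ‖deriv u t‖ₑ := by
      gcongr
      exact ((hu r R hr hrR).enorm_sub_le_lintegral_deriv hrR).trans
        (lintegral_mono_set Ioc_subset_Ioi_self)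
    _ = _ := add_comm _ _

/-! ### Integrals of a density against negative powers of its tail or head mass. -/

/-- If a measure on `ℝ` assigns mass at most `C` to all compact subsets of a measurable set, it
assigns mass at most `C` to the set. -/
theorem measure_le_of_forall_isCompact {μ : Measure ℝ} [IsFiniteMeasure μ] {E : Set ℝ}
    (hE : MeasurableSet E) {C : ℝ≥0∞}
    (h : ∀ K ⊆ E, IsCompact K → K.Nonempty → μ K ≤ C) : μ E ≤ C := by
  rw [hE.measure_eq_iSup_isCompact_of_ne_top (measure_ne_top μ E)]
  refine iSup₂_le fun K hK => iSup_le fun hKc => ?_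
  rcases K.eq_empty_or_nonempty with rfl | hne
  · simp
  · exact h K hK hKc hne

/-- A compact subset has a least element `t`, so it lies in `Ici t`, which has the mass of `Ioi t`
because there are no atoms. Compactness avoids asking whether the set contains its infimum. -/
theorem measure_setOf_measure_Ioi_lt_le {μ : Measure ℝ} [IsFiniteMeasure μ] [NullSingletonClass μ]
    (s : ℝ≥0∞) : μ {t | μ (Ioi t) < s} ≤ s := by
  have hanti : Antitone fun t => μ (Ioi t) := fun _ _ h => measure_mono (Ioi_subset_Ioi h)
  refine measure_le_of_forall_isCompact (hanti.measurable measurableSet_Iio) fun K hK hKc hne => ?_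
  obtain ⟨t, ht, hmin⟩ := hKc.exists_isLeast hne
  calc μ K ≤ μ (Ici t) := measure_mono fun x hx => hmin hx
    _ = μ (Ioi t) := measure_congr Ioi_ae_eq_Ici.symm
    _ ≤ s := (hK ht).le

theorem measure_setOf_measure_Iio_lt_le {μ : Measure ℝ} [IsFiniteMeasure μ] [NullSingletonClass μ]
    (s : ℝ≥0∞) : μ {t | μ (Iio t) < s} ≤ s := by
  have hmono : Monotone fun t => μ (Iio t) := fun _ _ h => measure_mono (Iio_subset_Iio h)
  refine measure_le_of_forall_isCompact (hmono.measurable measurableSet_Iio) fun K hK hKc hne => ?_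
  obtain ⟨t, ht, hmax⟩ := hKc.exists_isGreatest hne
  calc μ K ≤ μ (Iic t) := measure_mono fun x hx => hmax hx
    _ = μ (Iio t) := measure_congr Iio_ae_eq_Iic.symm
    _ ≤ s := (hK ht).le

/-- The hypothesis makes `G` at least as large in distribution as a uniform variable on `[0, μ
univ]`, so the worst case is `∫_0^M s^{-θ} ds` with `M = μ univ`. -/
theorem lintegral_rpow_neg_le_of_measure_lt_le {α : Type*} [MeasurableSpace α] {μ : Measure α}
    [IsFiniteMeasure μ] {G : α → ℝ≥0∞} (hG : Measurable G) (h : ∀ s, μ {x | G x < s} ≤ s)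
    {θ : ℝ} (hθ0 : 0 < θ) (hθ1 : θ < 1) :
    ∫⁻ x, G x ^ (-θ) ∂μ ≤ ENNReal.ofReal (1 / (1 - θ)) * μ univ ^ (1 - θ) := by
  by_cases hM0 : μ univ = 0
  · rw [Measure.measure_univ_eq_zero.1 hM0]; simp
  obtain ⟨m, hm⟩ : ∃ m : ℝ, m = (μ univ).toReal := ⟨_, rfl⟩
  have hmpos : 0 < m := hm ▸ ENNReal.toReal_pos hM0 (measure_ne_top _ _)
  have hM : μ univ = ENNReal.ofReal m := by rw [hm, ENNReal.ofReal_toReal (measure_ne_top _ _)]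
  -- Where `G = 0` the integrand is `∞`, which `toReal` would send to `0`.
  have hGpos : ∀ᵐ x ∂μ, G x ≠ 0 := by
    have h0 : μ {x | G x = 0} = 0 := by
      refine le_antisymm (ENNReal.le_of_forall_pos_le_add fun ε hε _ => ?_) zero_le
      rw [zero_add]
      refine (measure_mono fun x hx => ?_).trans (h ε)
      rw [mem_ofPred_eq] at hx ⊢
      rw [hx]
      exact_mod_cast hε
    rw [ae_iff]; simpa using h0
  let k : α → ℝ := fun x => (G x ^ (-θ)).toReal
  have hk0 : ∀ x, 0 ≤ k x := fun x => ENNReal.toReal_nonneg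
  have hkm : Measurable k := (hG.pow_const _).ennreal_toReal
  have heq : ∫⁻ x, G x ^ (-θ) ∂μ = ∫⁻ x, ENNReal.ofReal (k x) ∂μ := by
    refine lintegral_congr_ae (hGpos.mono fun x hx => (ENNReal.ofReal_toReal ?_).symm)
    simp [ENNReal.rpow_eq_top_iff, hx, hθ0.le]
  have hdist : ∀ t : ℝ, 0 < t → μ {x | t < k x} ≤ ENNReal.ofReal (t ^ (-θ⁻¹)) := fun t ht => by
    refine (measure_mono fun x hx => ?_).trans (h _)
    rw [mem_ofPred_eq] at hx ⊢
    have h1 : ENNReal.ofReal t < G x ^ (-θ) :=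
      (ENNReal.ofReal_lt_iff_lt_toReal ht.le (fun htop => by
        simp only [k, htop, ENNReal.toReal_top] at hx; exact absurd ht hx.not_gt)).2 hx
    rw [ENNReal.rpow_neg, ← ENNReal.inv_rpow] at h1
    have h2 := ENNReal.rpow_lt_rpow h1 (inv_pos.2 hθ0)
    rw [← ENNReal.rpow_mul, mul_inv_cancel₀ hθ0.ne', ENNReal.rpow_one] at h2
    rwa [← ENNReal.ofReal_rpow_of_pos ht, ENNReal.rpow_neg, ENNReal.lt_inv_iff_lt_inv]
  have hc : 0 < m ^ (-θ) := Real.rpow_pos_of_pos hmpos _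
  have hexp : -θ⁻¹ < -1 := by
    have := (one_lt_inv₀ hθ0).2 hθ1
    linarith
  -- The layer-cake integral is split at `m ^ (-θ)`, where the bound `t ^ (-θ⁻¹)` equals the total
  -- mass `m`.
  rw [heq, lintegral_eq_lintegral_meas_lt μ (Eventually.of_forall hk0) hkm.aemeasurable,
    ← Ioc_union_Ioi_eq_Ioi hc.le, lintegral_union measurableSet_Ioi Ioc_disjoint_Ioi_same]
  calc _ ≤ (∫⁻ t in Ioc 0 (m ^ (-θ)), ENNReal.ofReal m) +
        ∫⁻ t in Ioi (m ^ (-θ)), ENNReal.ofReal (t ^ (-θ⁻¹)) := by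
        refine add_le_add (lintegral_mono fun t => ?_)
          (setLIntegral_mono' measurableSet_Ioi fun t ht => hdist t (hc.trans ht))
        rw [← hM]; exact measure_mono (subset_univ _)
    _ = ENNReal.ofReal (m * m ^ (-θ)) +
        ENNReal.ofReal (-(m ^ (-θ)) ^ (-θ⁻¹ + 1) / (-θ⁻¹ + 1)) := by
        congr 1
        · simp [ENNReal.ofReal_mul hmpos.le]
        · rw [← integral_Ioi_rpow_of_lt hexp hc, ofReal_integral_eq_lintegral_ofReal
            (integrableOn_Ioi_rpow_of_lt hexp hc)]
          exact (ae_restrict_mem measurableSet_Ioi).mono fun t ht =>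
            Real.rpow_nonneg (hc.trans ht).le _
    _ = ENNReal.ofReal (1 / (1 - θ)) * μ univ ^ (1 - θ) := by
        have e1 : m * m ^ (-θ) = m ^ (1 - θ) := by
          rw [sub_eq_add_neg, Real.rpow_add hmpos, Real.rpow_one]
        have e2 : (m ^ (-θ)) ^ (-θ⁻¹ + 1) = m ^ (1 - θ) := by
          rw [← Real.rpow_mul hmpos.le]; congr 1; field_simp; ring
        have hθ' : (0 : ℝ) < 1 - θ := by linarith
        have hp := Real.rpow_pos_of_pos hmpos (1 - θ)
        have e3 : -m ^ (1 - θ) / (-θ⁻¹ + 1) = θ / (1 - θ) * m ^ (1 - θ) := by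
          have : -θ⁻¹ + 1 ≠ 0 := by linarith
          rw [show -θ⁻¹ + 1 = -((1 - θ) / θ) by field_simp; ring, neg_div_neg_eq]
          field_simp
        rw [e1, e2, e3, hM, ENNReal.ofReal_rpow_of_pos hmpos,
          ← ENNReal.ofReal_add hp.le (by positivity), ← ENNReal.ofReal_mul (by positivity)]
        congr 1
        field_simp
        ring

/-- Formally the substitution `s = ∫_t^∞ v`; passing to the distribution of the tail mass avoids
differentiating it. -/
theorem lintegral_tail_rpow_neg_le {v : ℝ → ℝ≥0∞} {r θ : ℝ}
    (hfin : ∫⁻ t in Ioi r, v t ≠ ∞) (hv : Measurable v) (hθ0 : 0 < θ) (hθ1 : θ < 1) :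
    ∫⁻ t in Ioi r, v t * (∫⁻ x in Ioi t, v x) ^ (-θ) ≤
      ENNReal.ofReal (1 / (1 - θ)) * (∫⁻ t in Ioi r, v t) ^ (1 - θ) := by
  let μ := (volume.restrict (Ioi r)).withDensity v
  have hμ : IsFiniteMeasure μ := isFiniteMeasure_withDensity hfin
  have hanti : Antitone fun t => μ (Ioi t) := fun _ _ h => measure_mono (Ioi_subset_Ioi h)
  have hkey := lintegral_rpow_neg_le_of_measure_lt_le hanti.measurable
    (fun s => measure_setOf_measure_Ioi_lt_le (μ := μ) s) hθ0 hθ1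
  rw [lintegral_withDensity_eq_lintegral_mul _ hv (hanti.measurable.pow_const _),
    withDensity_apply _ MeasurableSet.univ, Measure.restrict_univ] at hkey
  refine le_trans (le_of_eq (setLIntegral_congr_fun measurableSet_Ioi fun t ht => ?_)) hkey
  have : μ (Ioi t) = ∫⁻ x in Ioi t, v x := by
    rw [withDensity_apply _ measurableSet_Ioi, Measure.restrict_restrict measurableSet_Ioi,
      inter_eq_left.2 (Ioi_subset_Ioi (le_of_lt ht))]
  simp [this]

theorem lintegral_head_rpow_neg_le {w : ℝ → ℝ≥0∞} {a r θ : ℝ}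
    (hfin : ∫⁻ t in Ioo a r, w t ≠ ∞) (hw : Measurable w) (hθ0 : 0 < θ) (hθ1 : θ < 1) :
    ∫⁻ t in Ioo a r, w t * (∫⁻ x in Ioo a t, w x) ^ (-θ) ≤
      ENNReal.ofReal (1 / (1 - θ)) * (∫⁻ t in Ioo a r, w t) ^ (1 - θ) := by
  let μ := (volume.restrict (Ioo a r)).withDensity w
  have hμ : IsFiniteMeasure μ := isFiniteMeasure_withDensity hfin
  have hmono : Monotone fun t => μ (Iio t) := fun _ _ h => measure_mono (Iio_subset_Iio h)
  have hkey := lintegral_rpow_neg_le_of_measure_lt_le hmono.measurable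
    (fun s => measure_setOf_measure_Iio_lt_le (μ := μ) s) hθ0 hθ1
  rw [lintegral_withDensity_eq_lintegral_mul _ hw (hmono.measurable.pow_const _),
    withDensity_apply _ MeasurableSet.univ, Measure.restrict_univ] at hkey
  refine le_trans (le_of_eq (setLIntegral_congr_fun measurableSet_Ioo fun t ht => ?_)) hkey
  have : μ (Iio t) = ∫⁻ x in Ioo a t, w x := by
    rw [withDensity_apply _ measurableSet_Iio, Measure.restrict_restrict measurableSet_Iio]
    congr 2
    ext x
    simp only [mem_inter_iff, mem_Iio, mem_Ioo]
    exact ⟨fun h => ⟨h.2.1, h.1⟩, fun h => ⟨h.2, h.1, h.2.trans ht.2⟩⟩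
  simp [this]

/-! ### Doob's maximal argument. -/

theorem lintegral_rpow_eq_lintegral_measure_lt_mul_of_ne_top {α : Type*} [MeasurableSpace α]
    (μ : Measure α) {X : α → ℝ≥0∞} (hX : Measurable X) (hfin : ∀ x, X x ≠ ∞) {p : ℝ} (hp : 0 < p) :
    ∫⁻ x, X x ^ p ∂μ = ENNReal.ofReal p *
      ∫⁻ t in Ioi (0 : ℝ), μ {x | ENNReal.ofReal t < X x} * ENNReal.ofReal (t ^ (p - 1)) := by
  have h := lintegral_rpow_eq_lintegral_meas_lt_mul μ (f := fun x => (X x).toReal)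
    (Eventually.of_forall fun x => ENNReal.toReal_nonneg) hX.ennreal_toReal.aemeasurable hp
  have e1 : ∫⁻ x, X x ^ p ∂μ = ∫⁻ x, ENNReal.ofReal ((X x).toReal ^ p) ∂μ := by
    refine lintegral_congr fun x => ?_
    rw [← ENNReal.ofReal_rpow_of_nonneg ENNReal.toReal_nonneg hp.le,
      ENNReal.ofReal_toReal (hfin x)]
  rw [e1, h]
  congr 1
  refine setLIntegral_congr_fun measurableSet_Ioi fun t ht => ?_
  simp only [ENNReal.ofReal_lt_iff_lt_toReal (le_of_lt ht) (hfin _)]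

/-- Doob's `L^p` argument, for a bounded function: a weak-type bound with the sharp form on the
right-hand side gives the strong bound with constant `p / (p - 1)`. -/
theorem lintegral_rpow_le_of_mul_measure_le_of_bounded {α : Type*} [MeasurableSpace α]
    {ν : Measure α} [IsFiniteMeasure ν] {X g : α → ℝ≥0∞} (hX : Measurable X) (hg : Measurable g)
    {N : ℝ≥0∞} (hN : N ≠ ∞) (hXN : ∀ x, X x ≤ N) {p : ℝ} (hp : 1 < p)
    (h : ∀ c : ℝ, 0 < c → ENNReal.ofReal c * ν {x | ENNReal.ofReal c < X x} ≤
      ∫⁻ x in {x | ENNReal.ofReal c < X x}, g x ∂ν) :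
    ∫⁻ x, X x ^ p ∂ν ≤ ENNReal.ofReal ((p / (p - 1)) ^ p) * ∫⁻ x, g x ^ p ∂ν := by
  have hp0 : 0 < p := by linarith
  have hp1 : 0 < p - 1 := by linarith
  have hfin : ∀ x, X x ≠ ∞ := fun x => ne_top_of_le_ne_top hN (hXN x)
  have hpq : p.HolderConjugate (p / (p - 1)) := Real.HolderConjugate.conjExponent hp
  -- Boundedness of `X` serves here: a power of this integral is cancelled at the end.
  have hIfin : ∫⁻ x, X x ^ p ∂ν ≠ ∞ := by
    refine ne_top_of_le_ne_top (b := N ^ p * ν univ) ?_ ?_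
    · exact ENNReal.mul_ne_top (ENNReal.rpow_ne_top_of_nonneg hp0.le hN) (measure_ne_top _ _)
    · calc ∫⁻ x, X x ^ p ∂ν ≤ ∫⁻ _, N ^ p ∂ν :=
            lintegral_mono fun x => ENNReal.rpow_le_rpow (hXN x) hp0.le
        _ = _ := by simp
  -- Layer cake with exponent `p` for `ν`, the weak bound at each level, then layer cake back with
  -- exponent `p - 1` for `g dν`; the two prefactors leave `p / (p - 1)`.
  have hstep : ∫⁻ x, X x ^ p ∂ν ≤ ENNReal.ofReal (p / (p - 1)) *
      ∫⁻ x, (g * fun x => X x ^ (p - 1)) x ∂ν := by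
    rw [← lintegral_withDensity_eq_lintegral_mul _ hg (hX.pow_const _),
      lintegral_rpow_eq_lintegral_measure_lt_mul_of_ne_top _ hX hfin hp0,
      lintegral_rpow_eq_lintegral_measure_lt_mul_of_ne_top _ hX hfin hp1,
      ← mul_assoc, ← ENNReal.ofReal_mul (by positivity), div_mul_cancel₀ _ hp1.ne']
    gcongr 1
    refine setLIntegral_mono' measurableSet_Ioi fun t ht => ?_
    have ht : 0 < t := ht
    have e : t ^ (p - 1) = t * t ^ (p - 1 - 1) := by
      rw [Real.rpow_sub_one ht.ne' (p - 1)]; field_simp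
    rw [e, ENNReal.ofReal_mul ht.le, ← mul_assoc, mul_comm (ν _),
      withDensity_apply _ (measurableSet_lt measurable_const hX)]
    gcongr 1
    exact h t ht
  have hH := ENNReal.lintegral_mul_le_Lp_mul_Lq ν hpq hg.aemeasurable
    (hX.pow_const (p - 1)).aemeasurable
  have e2 : ∀ x, (X x ^ (p - 1)) ^ (p / (p - 1)) = X x ^ p := fun x => by
    rw [← ENNReal.rpow_mul]; congr 1; field_simp
  simp only [e2] at hH
  generalize hI : ∫⁻ x, X x ^ p ∂ν = I at *
  generalize hJ : ∫⁻ x, g x ^ p ∂ν = J at *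
  by_cases hI0 : I = 0
  · simp [hI0]
  have h3 : I ^ (1 / p) * I ^ (1 / (p / (p - 1))) ≤
      (ENNReal.ofReal (p / (p - 1)) * J ^ (1 / p)) * I ^ (1 / (p / (p - 1))) := by
    rw [← ENNReal.rpow_add _ _ hI0 hIfin]
    have : 1 / p + 1 / (p / (p - 1)) = 1 := by field_simp; ring
    rw [this, ENNReal.rpow_one, mul_assoc]
    exact hstep.trans (by gcongr)
  have hpos : I ^ (1 / (p / (p - 1))) ≠ 0 := by
    simp [ENNReal.rpow_eq_zero_iff, hI0, hIfin]
  have hne : I ^ (1 / (p / (p - 1))) ≠ ∞ := ENNReal.rpow_ne_top_of_nonneg (by positivity) hIfin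
  have h4 := (ENNReal.mul_le_mul_iff_left hpos hne).1 h3
  have h5 := ENNReal.rpow_le_rpow h4 hp0.le
  rwa [ENNReal.mul_rpow_of_nonneg _ _ hp0.le, ← ENNReal.rpow_mul, ← ENNReal.rpow_mul,
    one_div_mul_cancel hp0.ne', ENNReal.rpow_one, ENNReal.rpow_one,
    ENNReal.ofReal_rpow_of_nonneg (by positivity) hp0.le] at h5

theorem iSup_min_natCast (x : ℝ≥0∞) : ⨆ n : ℕ, min x n = x := by
  rw [← inf_iSup_eq, ENNReal.iSup_natCast, inf_top_eq]

/-- A bound for `ω`-measures of superlevel sets by `ν`-measures, together with Doob's weak-type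
bound for `ν`, gives a strong-type bound for `ω`. -/
theorem lintegral_rpow_le_of_measure_superlevel_le {α : Type*} [MeasurableSpace α]
    {ν ω : Measure α} [IsFiniteMeasure ν] {X g : α → ℝ≥0∞} (hX : Measurable X) (hg : Measurable g)
    {p : ℝ} (hp : 1 < p) {B : ℝ≥0∞} (hB : B ≠ ∞)
    (hω : ∀ c : ℝ, 0 < c → ω {x | ENNReal.ofReal c < X x} ≤ B * ν {x | ENNReal.ofReal c < X x})
    (h : ∀ c : ℝ, 0 < c → ENNReal.ofReal c * ν {x | ENNReal.ofReal c < X x} ≤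
      ∫⁻ x in {x | ENNReal.ofReal c < X x}, g x ∂ν) :
    ∫⁻ x, X x ^ p ∂ω ≤ ENNReal.ofReal ((p / (p - 1)) ^ p) * B * ∫⁻ x, g x ^ p ∂ν := by
  have hp0 : 0 < p := by linarith
  have hsup : ∀ x, X x ^ p = ⨆ n : ℕ, min (X x) n ^ p := fun x => by
    conv_lhs => rw [← iSup_min_natCast (X x)]
    exact (ENNReal.monotone_rpow_of_nonneg hp0.le).map_iSup_of_continuousAt
      (ENNReal.continuous_rpow_const.continuousAt) (by simp [hp0])
  simp_rw [hsup]
  rw [lintegral_iSup (fun n => (hX.min measurable_const).pow_const _)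
    (fun m n hmn x => by dsimp only; gcongr)]
  refine iSup_le fun n => ?_
  have hXn : Measurable fun x => min (X x) (n : ℝ≥0∞) := hX.min measurable_const
  -- Truncation at `n` either keeps a superlevel set or empties it, so both hypotheses survive.
  have hset : ∀ c : ℝ, {x | ENNReal.ofReal c < min (X x) n} = {x | ENNReal.ofReal c < X x} ∨
      {x | ENNReal.ofReal c < min (X x) n} = ∅ := fun c => by
    by_cases hc : ENNReal.ofReal c < n
    · left; ext x; simp [hc]
    · right; ext x; simp [hc]
  have hD := lintegral_rpow_le_of_mul_measure_le_of_bounded (ν := ν) hXn hg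
    (ENNReal.natCast_ne_top n) (fun x => min_le_right _ _) hp (fun c hc => by
      rcases hset c with e | e
      · rw [e]; exact h c hc
      · rw [e]; simp)
  have hfin : ∀ x, min (X x) (n : ℝ≥0∞) ≠ ∞ := fun x =>
    ne_top_of_le_ne_top (ENNReal.natCast_ne_top n) (min_le_right _ _)
  calc ∫⁻ x, min (X x) n ^ p ∂ω ≤ B * ∫⁻ x, min (X x) n ^ p ∂ν := by
        rw [lintegral_rpow_eq_lintegral_measure_lt_mul_of_ne_top _ hXn hfin hp0,
          lintegral_rpow_eq_lintegral_measure_lt_mul_of_ne_top _ hXn hfin hp0,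
          mul_left_comm, ← lintegral_const_mul' _ _ hB]
        gcongr 1
        refine setLIntegral_mono' measurableSet_Ioi fun t ht => ?_
        rw [← mul_assoc]
        gcongr 1
        rcases hset t with e | e
        · rw [e]; exact hω t ht
        · rw [e]; simp
    _ ≤ B * (ENNReal.ofReal ((p / (p - 1)) ^ p) * ∫⁻ x, g x ^ p ∂ν) := by gcongr
    _ = _ := by ring

/-! ### The inequality with `lowerB`. -/

theorem iUnion_Ioi_inv_natCast_add_one : ⋃ n : ℕ, Ioi (1 / ((n : ℝ) + 1)) = Ioi 0 := by
  ext x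
  simp only [mem_iUnion, mem_Ioi]
  exact ⟨fun ⟨n, hn⟩ => lt_trans (by positivity) hn, fun hx => exists_nat_one_div_lt hx⟩

/-- Needed because `tailInt` may blow up at `0`, so the Doob argument has finite measures only on
`(δ, ∞)`. -/
theorem setLIntegral_Ioi_zero_le_of_forall {h : ℝ → ℝ≥0∞} {C : ℝ≥0∞}
    (hC : ∀ δ : ℝ, 0 < δ → ∫⁻ r in Ioi δ, h r ≤ C) : ∫⁻ r in Ioi 0, h r ≤ C := by
  rw [← iUnion_Ioi_inv_natCast_add_one, setLIntegral_iUnion_of_directed]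
  · exact iSup_le fun n => hC _ (by positivity)
  · refine Monotone.directed_le fun m n hmn => Ioi_subset_Ioi ?_
    gcongr

theorem antitone_setLIntegral_Ioi (v : ℝ → ℝ≥0∞) : Antitone fun s => ∫⁻ t in Ioi s, v t :=
  fun _ _ h => lintegral_mono_set (Ioi_subset_Ioi h)

theorem antitone_tailInt (p : ℝ) (V : ℝ → ℝ≥0∞) : Antitone (tailInt p V) :=
  antitone_setLIntegral_Ioi _

theorem tailInt_ne_zero {p : ℝ} (hp : 1 < p) {V : ℝ → ℝ≥0∞} (hV : Measurable V)
    (hVtop : ∀ r, V r ≠ ∞) (s : ℝ) : tailInt p V s ≠ 0 := by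
  have hv : ∀ t, V t ^ (-(1 / (p - 1))) ≠ 0 := fun t => by
    simp [ENNReal.rpow_eq_zero_iff, hVtop t, hp.le]
  intro h
  rw [tailInt, lintegral_eq_zero_iff (hV.pow_const _)] at h
  have : ∀ᵐ x ∂volume.restrict (Ioi s), False := h.mono fun x hx => hv x hx
  rw [eventually_false_iff_eq_bot, ae_eq_bot] at this
  simpa using congrArg (fun μ : Measure ℝ => μ univ) this

theorem setLIntegral_restrict_withDensity_of_subset {v g : ℝ → ℝ≥0∞} (hv : Measurable v)
    (hg : Measurable g) {s δ : ℝ} (hs : δ ≤ s) :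
    ∫⁻ x in Ioi s, g x ∂((volume.restrict (Ioi δ)).withDensity v) = ∫⁻ x in Ioi s, v x * g x := by
  rw [setLIntegral_withDensity_eq_setLIntegral_mul _ hv hg measurableSet_Ioi,
    Measure.restrict_restrict measurableSet_Ioi, inter_eq_left.2 (Ioi_subset_Ioi hs)]
  rfl

theorem restrict_withDensity_Ioi_of_le (v : ℝ → ℝ≥0∞) {s δ : ℝ} (hs : δ ≤ s) :
    (volume.restrict (Ioi δ)).withDensity v (Ioi s) = ∫⁻ x in Ioi s, v x := by
  rw [withDensity_apply _ measurableSet_Ioi, Measure.restrict_restrict measurableSet_Ioi,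
    inter_eq_left.2 (Ioi_subset_Ioi hs)]

/-- The weighted Hardy inequality on a half-line `(δ, ∞)`, with the constant `lowerB`. -/
theorem lintegral_Ioi_hardy_le_lowerB {p : ℝ} (hp : 1 < p) {V W f : ℝ → ℝ≥0∞}
    (hV : Measurable V) (hW : Measurable W) (hf : Measurable f)
    (hV0 : ∀ r, V r ≠ 0) (hVtop : ∀ r, V r ≠ ∞)
    (hfin : ∀ s, 0 < s → tailInt p V s ≠ ∞) (hB : lowerB p V W ≠ ∞) {δ : ℝ} (hδ : 0 < δ) :
    ∫⁻ r in Ioi δ, W r * (∫⁻ t in Ioi r, f t) ^ p ≤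
      ENNReal.ofReal ((p / (p - 1)) ^ p) * lowerB p V W * ∫⁻ r in Ioi δ, V r * f r ^ p := by
  have hp0 : 0 < p := by linarith
  have hp1 : 0 < p - 1 := by linarith
  set B := lowerB p V W with hBdef
  let v : ℝ → ℝ≥0∞ := fun t => V t ^ (-(1 / (p - 1)))
  let F : ℝ → ℝ≥0∞ := fun s => ∫⁻ t in Ioi s, f t
  let Φ : ℝ → ℝ≥0∞ := tailInt p V
  have hv : Measurable v := hV.pow_const _
  have hv0 : ∀ t, v t ≠ 0 := fun t => by simp [v, ENNReal.rpow_eq_zero_iff, hVtop t, hp.le]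
  have hvtop : ∀ t, v t ≠ ∞ := fun t => by simp [v, ENNReal.rpow_eq_top_iff, hV0 t, hp.le]
  have hΦ : Measurable Φ := (antitone_tailInt p V).measurable
  have hΦ0 : ∀ s, Φ s ≠ 0 := tailInt_ne_zero hp hV hVtop
  let w : ℝ → ℝ≥0∞ := fun t => W t * Φ t ^ p
  have hw : Measurable w := hW.mul (hΦ.pow_const _)
  have hBs : ∀ s, 0 < s → ∫⁻ t in Ioi s, w t ≤ B * Φ s := fun s hs => by
    have h1 : (Φ s)⁻¹ * ∫⁻ t in Ioi s, w t ≤ B :=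
      le_iSup₂ (f := fun (s : ℝ) (_ : 0 < s) =>
        (tailInt p V s)⁻¹ * ∫⁻ t in Ioi s, W t * tailInt p V t ^ p) s hs
    rw [mul_comm, ← div_eq_mul_inv] at h1
    exact (ENNReal.div_le_iff (hΦ0 s) (hfin s hs)).1 h1
  let ν := (volume.restrict (Ioi δ)).withDensity v
  let ω := (volume.restrict (Ioi δ)).withDensity w
  have hνfin : IsFiniteMeasure ν := isFiniteMeasure_withDensity (hfin δ hδ)
  have hωfin : IsFiniteMeasure ω := isFiniteMeasure_withDensity
    (ne_top_of_le_ne_top (ENNReal.mul_ne_top hB (hfin δ hδ)) (hBs δ hδ))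
  let g : ℝ → ℝ≥0∞ := fun t => f t / v t
  have hg : Measurable g := hf.div hv
  have hvg : ∀ t, v t * g t = f t := fun t => ENNReal.mul_div_cancel (hv0 t) (hvtop t)
  -- The maximal function of the averages of `g` over half-lines; being monotone in `r`, it has
  -- half-lines as superlevel sets.
  let X : ℝ → ℝ≥0∞ := fun r => ⨆ s ∈ Icc δ r, F s / Φ s
  have hXmono : Monotone X := fun r r' h =>
    biSup_mono fun s hs => ⟨hs.1, hs.2.trans h⟩
  have hX : Measurable X := hXmono.measurable
  have hE : ∀ c : ℝ, MeasurableSet {x | ENNReal.ofReal c < X x} := fun c =>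
    measurableSet_lt measurable_const hX
  -- At the least point of `K`, the supremum supplies an `s` whose average exceeds `c`; then `X > c`
  -- on all of `Ioi s`, while `K ⊆ Ici s`.
  have hcover : ∀ (c : ℝ) (K : Set ℝ), K ⊆ {x | ENNReal.ofReal c < X x} → IsCompact K →
      K.Nonempty → ∃ s, δ ≤ s ∧ ENNReal.ofReal c * Φ s ≤ F s ∧ K ⊆ Ici s ∧
        Ioi s ⊆ {x | ENNReal.ofReal c < X x} := fun c K hK hKc hne => by
    obtain ⟨t, ht, hmin⟩ := hKc.exists_isLeast hne
    have htX : ENNReal.ofReal c < X t := hK ht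
    simp only [X, lt_iSup_iff] at htX
    obtain ⟨s, hs, hcs⟩ := htX
    refine ⟨s, hs.1, ?_, fun x hx => hs.2.trans (hmin hx), fun x hx => hcs.trans_le ?_⟩
    · exact (ENNReal.le_div_iff_mul_le (Or.inl (hΦ0 s))
        (Or.inl (hfin s (hδ.trans_le hs.1)))).1 hcs.le
    · exact le_iSup₂ (f := fun s (_ : s ∈ Icc δ x) => F s / Φ s) s ⟨hs.1, le_of_lt hx⟩
  have hmain := lintegral_rpow_le_of_measure_superlevel_le (ν := ν) (ω := ω) hX hg hp hB
    (fun c hc => measure_le_of_forall_isCompact (hE c) fun K hK hKc hne => by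
      obtain ⟨s, hδs, -, hKs, hsE⟩ := hcover c K hK hKc hne
      calc ω K ≤ ω (Ici s) := measure_mono hKs
        _ = ω (Ioi s) := measure_congr Ioi_ae_eq_Ici.symm
        _ = ∫⁻ t in Ioi s, w t := restrict_withDensity_Ioi_of_le w hδs
        _ ≤ B * Φ s := hBs s (hδ.trans_le hδs)
        _ = B * ν (Ioi s) := by rw [restrict_withDensity_Ioi_of_le v hδs]; rfl
        _ ≤ _ := by gcongr)
    (fun c hc => by
      have hc0 : ENNReal.ofReal c ≠ 0 := by simpa using hc
      rw [mul_comm, ← ENNReal.le_div_iff_mul_le (Or.inl hc0) (Or.inl ENNReal.ofReal_ne_top)]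
      refine measure_le_of_forall_isCompact (hE c) fun K hK hKc hne => ?_
      rw [ENNReal.le_div_iff_mul_le (Or.inl hc0) (Or.inl ENNReal.ofReal_ne_top), mul_comm]
      obtain ⟨s, hδs, hcs, hKs, hsE⟩ := hcover c K hK hKc hne
      calc ENNReal.ofReal c * ν K ≤ ENNReal.ofReal c * ν (Ici s) := by gcongr
        _ = ENNReal.ofReal c * ν (Ioi s) := by rw [measure_congr Ioi_ae_eq_Ici]
        _ = ENNReal.ofReal c * Φ s := by rw [restrict_withDensity_Ioi_of_le v hδs]; rfl
        _ ≤ F s := hcs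
        _ = ∫⁻ x in Ioi s, g x ∂ν := by
          rw [setLIntegral_restrict_withDensity_of_subset hv hg hδs]
          simp only [hvg, F]
        _ ≤ _ := lintegral_mono_set hsE)
  rw [lintegral_withDensity_eq_lintegral_mul _ hw (hX.pow_const _),
    lintegral_withDensity_eq_lintegral_mul _ hv (hg.pow_const _)] at hmain
  -- The density `v` is chosen so that `v ^ (1 - p) = V`.
  have hvV : ∀ t, v t * g t ^ p = V t * f t ^ p := fun t => by
    have e : v t ^ (1 - p) = V t := by
      simp only [v]
      rw [← ENNReal.rpow_mul, show -(1 / (p - 1)) * (1 - p) = 1 by field_simp; ring,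
        ENNReal.rpow_one]
    simp only [g]
    rw [ENNReal.div_rpow_of_nonneg _ _ hp0.le, div_eq_mul_inv, ← ENNReal.rpow_neg, mul_left_comm,
      ← e, sub_eq_add_neg, ENNReal.rpow_add _ _ (hv0 t) (hvtop t), ENNReal.rpow_one, mul_comm]
  simp only [Pi.mul_apply, hvV] at hmain
  refine le_trans (setLIntegral_mono' measurableSet_Ioi fun r hr => ?_) hmain
  have hr : δ < r := hr
  have hFX : F r / Φ r ≤ X r :=
    le_iSup₂ (f := fun s (_ : s ∈ Icc δ r) => F s / Φ s) r ⟨hr.le, le_rfl⟩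
  have : F r ≤ X r * Φ r :=
    (ENNReal.div_le_iff (hΦ0 r) (hfin r (hδ.trans hr))).1 hFX
  calc W r * F r ^ p ≤ W r * (X r * Φ r) ^ p := by gcongr
    _ = w r * X r ^ p := by
      rw [ENNReal.mul_rpow_of_nonneg _ _ hp0.le]; simp only [w]; ring

/-! ### The inequality with `upperB`. -/

theorem lintegral_Ioi_mul_tail_eq {h k : ℝ → ℝ≥0∞} (hh : Measurable h) (hk : Measurable k) :
    ∫⁻ r in Ioi 0, h r * ∫⁻ t in Ioi r, k t = ∫⁻ t in Ioi 0, k t * ∫⁻ r in Ioo 0 t, h r := by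
  have hS : MeasurableSet {z : ℝ × ℝ | z.1 < z.2} := measurableSet_lt measurable_fst measurable_snd
  have hmeas : Measurable ({z : ℝ × ℝ | z.1 < z.2}.indicator fun z => h z.1 * k z.2) :=
    ((hh.comp measurable_fst).mul (hk.comp measurable_snd)).indicator hS
  have e1 : ∀ r ∈ Ioi (0 : ℝ), h r * ∫⁻ t in Ioi r, k t =
      ∫⁻ t in Ioi 0, {z : ℝ × ℝ | z.1 < z.2}.indicator (fun z => h z.1 * k z.2) (r, t) := by
    intro r hr
    have : ∀ t, {z : ℝ × ℝ | z.1 < z.2}.indicator (fun z => h z.1 * k z.2) (r, t) =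
        (Ioi r).indicator (fun t => h r * k t) t := fun t => by
      simp [indicator]
    simp only [this]
    rw [lintegral_indicator measurableSet_Ioi, Measure.restrict_restrict measurableSet_Ioi,
      inter_eq_left.2 (Ioi_subset_Ioi (le_of_lt hr)), lintegral_const_mul _ hk]
  have e2 : ∀ t ∈ Ioi (0 : ℝ), k t * ∫⁻ r in Ioo 0 t, h r =
      ∫⁻ r in Ioi 0, {z : ℝ × ℝ | z.1 < z.2}.indicator (fun z => h z.1 * k z.2) (r, t) := by
    intro t ht
    have : ∀ r, {z : ℝ × ℝ | z.1 < z.2}.indicator (fun z => h z.1 * k z.2) (r, t) =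
        (Iio t).indicator (fun r => k t * h r) r := fun r => by
      simp [indicator, mul_comm]
    simp only [this]
    rw [lintegral_indicator measurableSet_Iio, Measure.restrict_restrict measurableSet_Iio,
      Iio_inter_Ioi, lintegral_const_mul _ hh]
  rw [setLIntegral_congr_fun measurableSet_Ioi e1, setLIntegral_congr_fun measurableSet_Ioi e2]
  exact lintegral_lintegral_swap hmeas.aemeasurable

/-- Hölder's inequality for the tail of `f`, with weight a power of the tail `tailInt`. -/
theorem tail_rpow_le_mul_lintegral {p : ℝ} (hp : 1 < p) {V f : ℝ → ℝ≥0∞}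
    (hV : Measurable V) (hf : Measurable f)
    (hV0 : ∀ r, V r ≠ 0) (hVtop : ∀ r, V r ≠ ∞)
    (hfin : ∀ s, 0 < s → tailInt p V s ≠ ∞) {r : ℝ} (hr : 0 < r) :
    (∫⁻ t in Ioi r, f t) ^ p ≤
      ENNReal.ofReal (p / (p - 1)) ^ (p - 1) * (tailInt p V r ^ (p - 1)) ^ (1 - 1 / p) *
        ∫⁻ t in Ioi r, V t * f t ^ p * tailInt p V t ^ (1 - 1 / p) := by
  have hp0 : 0 < p := by linarith
  have hp1 : 0 < p - 1 := by linarith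
  let Φ : ℝ → ℝ≥0∞ := tailInt p V
  have hΦ : Measurable Φ := (antitone_tailInt p V).measurable
  have hΦ0 : ∀ s, Φ s ≠ 0 := tailInt_ne_zero hp hV hVtop
  -- With `q = p / (p - 1)`, this gives `a * p = 1 - 1 / p` and `a * q = 1 / p`, so the dual factor
  -- becomes `v * Φ ^ (-(1 / p))`, integrable by `lintegral_tail_rpow_neg_le`.
  obtain ⟨a, ha⟩ : ∃ a : ℝ, a = (p - 1) / (p * p) := ⟨_, rfl⟩
  let X : ℝ → ℝ≥0∞ := fun t => f t * (V t ^ (1 / p) * Φ t ^ a)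
  let Y : ℝ → ℝ≥0∞ := fun t => (V t ^ (1 / p) * Φ t ^ a)⁻¹
  have hX : Measurable X := hf.mul ((hV.pow_const _).mul (hΦ.pow_const _))
  have hY : Measurable Y := ((hV.pow_const _).mul (hΦ.pow_const _)).inv
  have hH := ENNReal.lintegral_mul_le_Lp_mul_Lq (volume.restrict (Ioi r))
    (q := p / (p - 1)) (Real.HolderConjugate.conjExponent hp) hX.aemeasurable hY.aemeasurable
  have e1 : ∫⁻ t in Ioi r, (X * Y) t = ∫⁻ t in Ioi r, f t := by
    refine setLIntegral_congr_fun measurableSet_Ioi fun t ht => ?_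
    have hΦt : Φ t ≠ ∞ := hfin t (hr.trans ht)
    simp only [Pi.mul_apply, X, Y]
    rw [mul_assoc, ENNReal.mul_inv_cancel, mul_one]
    · exact mul_ne_zero (by simp [ENNReal.rpow_eq_zero_iff, hV0 t, hVtop t])
        (by simp [ENNReal.rpow_eq_zero_iff, hΦ0 t, hΦt])
    · exact ENNReal.mul_ne_top (by simp [ENNReal.rpow_eq_top_iff, hV0 t, hVtop t])
        (by simp [ENNReal.rpow_eq_top_iff, hΦ0 t, hΦt])
  have e2 : ∀ t, X t ^ p = V t * f t ^ p * Φ t ^ (1 - 1 / p) := fun t => by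
    simp only [X]
    rw [ENNReal.mul_rpow_of_nonneg _ _ hp0.le, ENNReal.mul_rpow_of_nonneg _ _ hp0.le,
      ← ENNReal.rpow_mul, ← ENNReal.rpow_mul, one_div_mul_cancel hp0.ne', ENNReal.rpow_one,
      show a * p = 1 - 1 / p by rw [ha]; field_simp]
    ring
  have e3 : ∀ t ∈ Ioi r, Y t ^ (p / (p - 1)) = V t ^ (-(1 / (p - 1))) * Φ t ^ (-(1 / p)) := by
    intro t ht
    simp only [Y]
    rw [ENNReal.inv_rpow, ENNReal.mul_rpow_of_nonneg _ _ (by positivity), ← ENNReal.rpow_mul,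
      ← ENNReal.rpow_mul, ENNReal.mul_inv, ← ENNReal.rpow_neg, ← ENNReal.rpow_neg]
    · congr 2
      · field_simp
      · rw [ha]; field_simp
    · left; simp [ENNReal.rpow_eq_zero_iff, hV0 t, hVtop t]
    · left; simp [ENNReal.rpow_eq_top_iff, hV0 t, hVtop t]
  have hYint : ∫⁻ t in Ioi r, Y t ^ (p / (p - 1)) ≤
      ENNReal.ofReal (p / (p - 1)) * Φ r ^ (1 - 1 / p) := by
    rw [setLIntegral_congr_fun measurableSet_Ioi e3]
    have := lintegral_tail_rpow_neg_le (hfin r hr) (hV.pow_const _) (θ := 1 / p) (by positivity)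
      ((div_lt_one hp0).2 hp)
    rwa [show 1 / (1 - 1 / p) = p / (p - 1) by field_simp] at this
  rw [e1] at hH
  simp only [e2] at hH
  calc (∫⁻ t in Ioi r, f t) ^ p
      ≤ ((∫⁻ t in Ioi r, V t * f t ^ p * Φ t ^ (1 - 1 / p)) ^ (1 / p) *
        (ENNReal.ofReal (p / (p - 1)) * Φ r ^ (1 - 1 / p)) ^ (1 / (p / (p - 1)))) ^ p := by
        refine ENNReal.rpow_le_rpow (hH.trans ?_) hp0.le
        gcongr
    _ = _ := by
        rw [ENNReal.mul_rpow_of_nonneg _ _ hp0.le, ← ENNReal.rpow_mul, ← ENNReal.rpow_mul,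
          one_div_mul_cancel hp0.ne', ENNReal.rpow_one,
          show 1 / (p / (p - 1)) * p = p - 1 by field_simp,
          ENNReal.mul_rpow_of_nonneg _ _ hp1.le, ← ENNReal.rpow_mul, ← ENNReal.rpow_mul,
          mul_comm (p - 1) (1 - 1 / p), mul_comm]

/-- The weighted Hardy inequality with the constant `upperB`, when this constant is nondegenerate. -/
theorem lintegral_hardy_le_upperB {p : ℝ} (hp : 1 < p) {V W f : ℝ → ℝ≥0∞}
    (hV : Measurable V) (hW : Measurable W) (hf : Measurable f)
    (hV0 : ∀ r, V r ≠ 0) (hVtop : ∀ r, V r ≠ ∞)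
    (hfin : ∀ s, 0 < s → tailInt p V s ≠ ∞) (hB : upperB p V W ≠ ∞) (hB0 : upperB p V W ≠ 0) :
    ∫⁻ r in Ioi 0, W r * (∫⁻ t in Ioi r, f t) ^ p ≤
      ENNReal.ofReal (p ^ p / (p - 1) ^ (p - 1)) * upperB p V W *
        ∫⁻ r in Ioi 0, V r * f r ^ p := by
  have hp0 : 0 < p := by linarith
  have hp1 : 0 < p - 1 := by linarith
  obtain ⟨θ, hθ⟩ : ∃ θ : ℝ, θ = 1 - 1 / p := ⟨_, rfl⟩
  have hpinv : 1 / p < 1 := (div_lt_one hp0).2 hp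
  have hpinv0 : 0 < 1 / p := by positivity
  have hθ0 : 0 < θ := by rw [hθ]; linarith
  have hθ1 : θ < 1 := by rw [hθ]; linarith
  set B := upperB p V W with hBdef
  let Φ : ℝ → ℝ≥0∞ := tailInt p V
  let H : ℝ → ℝ≥0∞ := fun s => ∫⁻ t in Ioo 0 s, W t
  have hHmono : Monotone H := fun _ _ h => lintegral_mono_set (Ioo_subset_Ioo_right h)
  have hΦ : Measurable Φ := (antitone_tailInt p V).measurable
  have hΦ0 : ∀ s, Φ s ≠ 0 := tailInt_ne_zero hp hV hVtop
  have hBs : ∀ s, 0 < s → Φ s ^ (p - 1) * H s ≤ B := fun s hs =>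
    le_iSup₂ (f := fun (s : ℝ) (_ : 0 < s) => tailInt p V s ^ (p - 1) * ∫⁻ t in Ioo 0 s, W t) s hs
  have hΦp : ∀ s, 0 < s → Φ s ^ (p - 1) ≠ 0 := fun s hs => by
    simp [ENNReal.rpow_eq_zero_iff, hΦ0 s, hp.le]
  have hHfin : ∀ s, 0 < s → H s ≠ ∞ := fun s hs htop => by
    have := hBs s hs
    rw [htop, ENNReal.mul_top (hΦp s hs)] at this
    exact hB (top_le_iff.1 this)
  let k : ℝ → ℝ≥0∞ := fun t => V t * f t ^ p * Φ t ^ θ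
  have hk : Measurable k := (hV.mul (hf.pow_const _)).mul (hΦ.pow_const _)
  let D := ENNReal.ofReal (p / (p - 1)) ^ (p - 1)
  let h : ℝ → ℝ≥0∞ := fun r => W r * H r ^ (-θ)
  have hh : Measurable h := hW.mul (hHmono.measurable.pow_const _)
  calc ∫⁻ r in Ioi 0, W r * (∫⁻ t in Ioi r, f t) ^ p
      ≤ ∫⁻ r in Ioi 0, D * B ^ θ * (h r * ∫⁻ t in Ioi r, k t) := by
        refine setLIntegral_mono' measurableSet_Ioi fun r hr => ?_
        have h1 := tail_rpow_le_mul_lintegral hp hV hf hV0 hVtop hfin hr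
        rw [← hθ] at h1
        -- `H r = 0` is allowed: since `B ≠ 0`, the quotient is then `∞`.
        have h2 : Φ r ^ (p - 1) ≤ B / H r :=
          (ENNReal.le_div_iff_mul_le (Or.inr hB0) (Or.inr hB)).2 (hBs r hr)
        have h3 : (Φ r ^ (p - 1)) ^ θ ≤ B ^ θ * H r ^ (-θ) := by
          refine (ENNReal.rpow_le_rpow h2 hθ0.le).trans_eq ?_
          rw [ENNReal.div_rpow_of_nonneg _ _ hθ0.le, div_eq_mul_inv, ENNReal.rpow_neg]
        calc W r * (∫⁻ t in Ioi r, f t) ^ p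
            ≤ W r * (D * (B ^ θ * H r ^ (-θ)) * ∫⁻ t in Ioi r, k t) := by
              gcongr
              exact h1.trans (by gcongr)
          _ = _ := by simp only [h]; ring
    _ = D * B ^ θ * ∫⁻ t in Ioi 0, k t * ∫⁻ r in Ioo 0 t, h r := by
        have hDB : D * B ^ θ ≠ ∞ := ENNReal.mul_ne_top
          (ENNReal.rpow_ne_top_of_nonneg hp1.le ENNReal.ofReal_ne_top)
          (ENNReal.rpow_ne_top_of_nonneg hθ0.le hB)
        rw [lintegral_const_mul' _ _ hDB, lintegral_Ioi_mul_tail_eq hh hk]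
    _ ≤ D * B ^ θ * ∫⁻ t in Ioi 0, ENNReal.ofReal p * B ^ (1 / p) * (V t * f t ^ p) := by
        gcongr 1
        refine setLIntegral_mono' measurableSet_Ioi fun t ht => ?_
        have h1 := lintegral_head_rpow_neg_le (hHfin t ht) hW hθ0 hθ1
        rw [show 1 - θ = 1 / p by rw [hθ]; ring, one_div_one_div] at h1
        -- As `θ = (p - 1) / p`, the left side is `(Φ ^ (p - 1) * H) ^ (1 / p)`.
        have h2 : Φ t ^ θ * H t ^ (1 / p) ≤ B ^ (1 / p) := by
          rw [show θ = (p - 1) * (1 / p) by rw [hθ]; field_simp, ENNReal.rpow_mul,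
            ← ENNReal.mul_rpow_of_nonneg _ _ hpinv0.le]
          exact ENNReal.rpow_le_rpow (hBs t ht) hpinv0.le
        calc k t * ∫⁻ r in Ioo 0 t, h r
            ≤ k t * (ENNReal.ofReal p * H t ^ (1 / p)) := by gcongr
          _ = ENNReal.ofReal p * (Φ t ^ θ * H t ^ (1 / p)) * (V t * f t ^ p) := by
              simp only [k]; ring
          _ ≤ _ := by gcongr
    _ = (ENNReal.ofReal p * D) * (B ^ θ * B ^ (1 / p)) * ∫⁻ t in Ioi 0, V t * f t ^ p := by
        rw [lintegral_const_mul' _ _ (ENNReal.mul_ne_top ENNReal.ofReal_ne_top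
          (ENNReal.rpow_ne_top_of_nonneg hpinv0.le hB))]
        ring
    _ = _ := by
        rw [← ENNReal.rpow_add _ _ hB0 hB, show θ + 1 / p = 1 by rw [hθ]; ring, ENNReal.rpow_one]
        congr 2
        simp only [D]
        -- The constant is `p * (p / (p - 1)) ^ (p - 1)`.
        rw [ENNReal.ofReal_rpow_of_nonneg (by positivity) hp1.le, ← ENNReal.ofReal_mul hp0.le,
          Real.div_rpow hp0.le hp1.le, ← mul_div_assoc, ← Real.rpow_one_add' hp0.le (by linarith)]
        congr 3
        ring

/-! ### Degenerate constants, null-set modifications and the conclusion. -/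

theorem lintegral_mul_tail_rpow_eq_zero {p : ℝ} (hp : 0 < p) {V W f : ℝ → ℝ≥0∞}
    (hV : Measurable V) (hf : Measurable f) (hV0 : ∀ r, V r ≠ 0)
    (h : ∫⁻ r in Ioi 0, V r * f r ^ p = 0) :
    ∫⁻ r in Ioi 0, W r * (∫⁻ t in Ioi r, f t) ^ p = 0 := by
  replace h := (lintegral_eq_zero_iff (hV.mul (hf.pow_const p))).1 h
  have hf0 : ∀ᵐ t ∂volume.restrict (Ioi (0 : ℝ)), f t = 0 := h.mono fun t ht => by
    simpa [hV0 t, ENNReal.rpow_eq_zero_iff, hp, hp.le, hp.not_gt] using ht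
  have htail : ∀ r ∈ Ioi (0 : ℝ), W r * (∫⁻ t in Ioi r, f t) ^ p = 0 := fun r hr => by
    have : ∫⁻ t in Ioi r, f t = 0 := by
      rw [lintegral_eq_zero_iff hf]
      exact ae_restrict_of_ae_restrict_of_subset (Ioi_subset_Ioi (le_of_lt hr)) hf0
    rw [this, ENNReal.zero_rpow_of_pos hp, mul_zero]
  rw [setLIntegral_congr_fun measurableSet_Ioi htail, lintegral_zero]

/-- Both weighted Hardy inequalities, for the tail integral of a measurable function. -/
theorem weighted_hardy_tail {p : ℝ} (hp : 1 < p) {V W f : ℝ → ℝ≥0∞}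
    (hV : Measurable V) (hW : Measurable W) (hf : Measurable f)
    (hV0 : ∀ r, V r ≠ 0) (hVtop : ∀ r, V r ≠ ∞) (hfin : ∀ s, 0 < s → tailInt p V s ≠ ∞) :
    (∫⁻ r in Ioi 0, W r * (∫⁻ t in Ioi r, f t) ^ p ≤
      ENNReal.ofReal (p ^ p / (p - 1) ^ (p - 1)) * upperB p V W *
        ∫⁻ r in Ioi 0, V r * f r ^ p) ∧
    (∫⁻ r in Ioi 0, W r * (∫⁻ t in Ioi r, f t) ^ p ≤
      ENNReal.ofReal ((p / (p - 1)) ^ p) * lowerB p V W *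
        ∫⁻ r in Ioi 0, V r * f r ^ p) := by
  have hp0 : 0 < p := by linarith
  have hp1 : 0 < p - 1 := by linarith
  -- If this integral vanishes, an infinite constant gives `∞ * 0 = 0` on the right, so the left
  -- side must vanish too.
  by_cases hI : ∫⁻ r in Ioi 0, V r * f r ^ p = 0
  · rw [lintegral_mul_tail_rpow_eq_zero hp0 hV hf hV0 hI]
    exact ⟨zero_le, zero_le⟩
  have htop : ∀ {c : ℝ}, 0 < c →
      ENNReal.ofReal c * ∞ * ∫⁻ r in Ioi 0, V r * f r ^ p = ∞ := fun hc => by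
    rw [ENNReal.mul_top (by simpa using hc), ENNReal.top_mul hI]
  constructor
  · by_cases hB : upperB p V W = ∞
    · rw [hB, htop (by positivity)]; exact le_top
    by_cases hB0 : upperB p V W = 0
    · have hW0 : ∫⁻ r in Ioi 0, W r = 0 := by
        have hU : Ioi (0 : ℝ) = ⋃ n : ℕ, Ioo 0 ((n : ℝ) + 1) := by
          ext x
          simp only [mem_iUnion, mem_Ioo, mem_Ioi, exists_and_left, iff_self_and]
          exact fun _ => (exists_nat_gt x).imp fun n hn => hn.trans (lt_add_one _)
        rw [hU, setLIntegral_iUnion_of_directed]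
        · simp only [ENNReal.iSup_eq_zero]
          intro n
          simp only [upperB, ENNReal.iSup_eq_zero, mul_eq_zero] at hB0
          refine (hB0 ((n : ℝ) + 1) (by positivity)).resolve_left ?_
          simp [ENNReal.rpow_eq_zero_iff, tailInt_ne_zero hp hV hVtop, hp.le]
        · refine Monotone.directed_le fun m n hmn => Ioo_subset_Ioo_right ?_
          gcongr
      rw [lintegral_eq_zero_iff hW] at hW0
      refine le_of_eq_of_le ?_ zero_le
      rw [← lintegral_zero (μ := volume.restrict (Ioi (0 : ℝ)))]
      refine lintegral_congr_ae (hW0.mono fun r hr => ?_)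
      simp only [hr, Pi.zero_apply, zero_mul]
    exact lintegral_hardy_le_upperB hp hV hW hf hV0 hVtop hfin hB hB0
  · by_cases hB : lowerB p V W = ∞
    · rw [hB, htop (by positivity)]; exact le_top
    refine setLIntegral_Ioi_zero_le_of_forall fun δ hδ =>
      (lintegral_Ioi_hardy_le_lowerB hp hV hW hf hV0 hVtop hfin hB hδ).trans ?_
    gcongr

theorem tailInt_congr_ae {p : ℝ} {V V' : ℝ → ℝ≥0∞} (h : V =ᵐ[volume.restrict (Ioi 0)] V')
    {s : ℝ} (hs : 0 < s) : tailInt p V s = tailInt p V' s := by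
  refine lintegral_congr_ae ?_
  filter_upwards [ae_restrict_of_ae_restrict_of_subset (Ioi_subset_Ioi hs.le) h] with t ht
  rw [ht]

theorem upperB_congr_ae {p : ℝ} {V V' W W' : ℝ → ℝ≥0∞} (hV : V =ᵐ[volume.restrict (Ioi 0)] V')
    (hW : W =ᵐ[volume.restrict (Ioi 0)] W') : upperB p V W = upperB p V' W' := by
  refine iSup_congr fun s => iSup_congr fun hs => ?_
  rw [tailInt_congr_ae hV hs,
    lintegral_congr_ae (ae_restrict_of_ae_restrict_of_subset Ioo_subset_Ioi_self hW)]

theorem lowerB_congr_ae {p : ℝ} {V V' W W' : ℝ → ℝ≥0∞} (hV : V =ᵐ[volume.restrict (Ioi 0)] V')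
    (hW : W =ᵐ[volume.restrict (Ioi 0)] W') : lowerB p V W = lowerB p V' W' := by
  refine iSup_congr fun s => iSup_congr fun hs => ?_
  rw [tailInt_congr_ae hV hs]
  congr 1
  refine lintegral_congr_ae ?_
  filter_upwards [ae_restrict_of_ae_restrict_of_subset (Ioi_subset_Ioi hs.le) hW,
    ae_restrict_mem measurableSet_Ioi] with t ht hst
  rw [ht, tailInt_congr_ae hV (hs.trans hst)]

/-- A zero of `V` makes the integrand `∞`, which a finite integral permits only on a null set. -/
theorem ae_ne_zero_of_tailInt_lt_top {p : ℝ} (hp : 1 < p) {V : ℝ → ℝ≥0∞}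
    (hV : AEMeasurable V (volume.restrict (Ioi 0)))
    (hint : ∀ s : ℝ, 0 < s → ∫⁻ t in Ioi s, V t ^ (-(1 / (p - 1))) < ∞) :
    ∀ᵐ r ∂volume.restrict (Ioi (0 : ℝ)), V r ≠ 0 := by
  rw [← iUnion_Ioi_inv_natCast_add_one, ae_restrict_iUnion_iff]
  intro n
  have hn : (0 : ℝ) < 1 / ((n : ℝ) + 1) := by positivity
  filter_upwards [ae_lt_top' ((hV.mono_set (Ioi_subset_Ioi hn.le)).pow_const _)
    (hint _ hn).ne] with r hr h0
  have hneg : -(1 / (p - 1)) < 0 := by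
    have : 0 < p - 1 := by linarith
    simpa using this
  rw [h0, ENNReal.zero_rpow_of_neg hneg] at hr
  exact lt_irrefl _ hr

theorem theorem4 {𝕜 : Type*} [RCLike 𝕜] (p : ℝ) (hp : 1 < p) (V W : ℝ → ℝ≥0∞)
    (hVm : AEMeasurable V (volume.restrict (Ioi 0)))
    (hWm : AEMeasurable W (volume.restrict (Ioi 0)))
    (hVfin : ∀ᵐ r ∂volume.restrict (Ioi (0 : ℝ)), V r < ∞)
    (hWfin : ∀ᵐ r ∂volume.restrict (Ioi (0 : ℝ)), W r < ∞)
    (hVint : ∀ s : ℝ, 0 < s → ∫⁻ t in Ioi s, V t ^ (-(1 / (p - 1))) < ∞)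
    (u : ℝ → 𝕜) (hu : LocallyACOnPos u)
    (hlim : liminf (fun r : ℝ => ‖u r‖ₑ) atTop = 0) :
    (∫⁻ r in Ioi (0 : ℝ), W r * ‖u r‖ₑ ^ p ≤
        ENNReal.ofReal (p ^ p / (p - 1) ^ (p - 1)) * upperB p V W *
          ∫⁻ r in Ioi (0 : ℝ), V r * ‖deriv u r‖ₑ ^ p) ∧
      (∫⁻ r in Ioi (0 : ℝ), W r * ‖u r‖ₑ ^ p ≤
        ENNReal.ofReal ((p / (p - 1)) ^ p) * lowerB p V W *
          ∫⁻ r in Ioi (0 : ℝ), V r * ‖deriv u r‖ₑ ^ p) := by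
  have hV0 := ae_ne_zero_of_tailInt_lt_top hp hVm hVint
  -- A Borel version of `V` with values in `(0, ∞)` everywhere; the value `1` is arbitrary, being
  -- used only on a null subset of `(0, ∞)` and off that half-line.
  let V' : ℝ → ℝ≥0∞ := fun r => if hVm.mk V r = 0 ∨ hVm.mk V r = ∞ then 1 else hVm.mk V r
  have hV'm : Measurable V' := by
    have hm := hVm.measurable_mk
    exact Measurable.ite ((hm (measurableSet_singleton 0)).union (hm (measurableSet_singleton ∞)))
      measurable_const hm
  have hVV' : V =ᵐ[volume.restrict (Ioi 0)] V' := by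
    filter_upwards [hVm.ae_eq_mk, hV0, hVfin] with r hr h0 hfin
    simp only [V', ← hr, h0, hfin.ne, or_self, if_false]
  have hV'0 : ∀ r, V' r ≠ 0 := fun r => by
    simp only [V']; split_ifs with h
    · exact one_ne_zero
    · exact fun h0 => h (Or.inl h0)
  have hV'top : ∀ r, V' r ≠ ∞ := fun r => by
    simp only [V']; split_ifs with h
    · exact ENNReal.one_ne_top
    · exact fun h0 => h (Or.inr h0)
  have hWW' := hWm.ae_eq_mk
  have hmain := weighted_hardy_tail hp hV'm hWm.measurable_mk (measurable_deriv u).enorm hV'0 hV'top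
    (fun s hs => tailInt_congr_ae hVV' hs ▸ (hVint s hs).ne)
  rw [← upperB_congr_ae hVV' hWW', ← lowerB_congr_ae hVV' hWW'] at hmain
  have hRHS : ∫⁻ r in Ioi 0, V' r * ‖deriv u r‖ₑ ^ p = ∫⁻ r in Ioi 0, V r * ‖deriv u r‖ₑ ^ p :=
    lintegral_congr_ae (hVV'.mono fun r hr => by simp only [hr])
  rw [hRHS] at hmain
  have hLHS : ∫⁻ r in Ioi (0 : ℝ), W r * ‖u r‖ₑ ^ p ≤
      ∫⁻ r in Ioi 0, hWm.mk W r * (∫⁻ t in Ioi r, ‖deriv u t‖ₑ) ^ p := by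
    refine lintegral_mono_ae ?_
    filter_upwards [hWW', ae_restrict_mem measurableSet_Ioi] with r hr hr0
    rw [hr]
    gcongr
    exact hu.enorm_le_lintegral_deriv hlim hr0
  exact ⟨hLHS.trans hmain.1, hLHS.trans hmain.2⟩
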